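/- Let $m\in\mathbb N$ and let $A=\{A(k)\}_{k\in\mathbb Z}$, $B=\{B(k)\}_{k\in\mathbb Z}$ be sequences of complex self-adjoint $m\times m$ matrices with every $A(k)$ positive definite and $\sup_{k}(\|A(k)\|+\|B(k)\|)<\infty$. The associated Jacobi operator $H$ is the bounded operator on $\ell^2(\mathbb Z)^m$ given by $$(Hf)(k)=A(k)f(k+1)+A(k-1)f(k-1)+B(k)f(k),\qquad k\in\mathbb Z.$$ Fix $k_0\in\mathbb Z$. For $z\in\mathbb C$ let $\theta(z,\cdot,k_0)$, $\phi(z,\cdot,k_0)$ be the $m\times m$ matrix-valued solutions of $$A(k)\psi(k+1)+A(k-1)\psi(k-1)+(B(k)-zI_m)\psi(k)=0,\qquad k\in\mathbb Z,$$ with $\theta(z,k_0,k_0)=\phi(z,k_0+1,k_0)=I_m$ and $\phi(z,k_0,k_0)=\theta(z,k_0+1,k_0)=0$. For $z\in\mathbb C\setminus\mathbb R$ let $M_\pm(z,k_0)$ be the unique $m\times m$ matrix for which $\theta(z,\cdot,k_0)-\phi(z,\cdot,k_0)A(k_0)^{-1}M_\pm(z,k_0)$ is square summable on $(k_0,\pm\infty)\cap\mathbb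 Z$, and (writing $M_\pm=M_\pm(z,k_0)$) define the $2m\times 2m$ Weyl–Titchmarsh matrix $$M(z,k_0)=\begin{pmatrix}[M_--M_+]^{-1} & \tfrac12[M_--M_+]^{-1}[M_-+M_+]\\ \tfrac12[M_-+M_+][M_--M_+]^{-1} & M_+[M_--M_+]^{-1}M_-\end{pmatrix}.$$ **Theorem 4.2.** $M(z,k_0)$ for all $z\in\mathbb C_+=\{z:\operatorname{Im}z>0\}$ uniquely determines $H$, and hence $A$ and $B$: if $(A_1,B_1)$ and $(A_2,B_2)$ are two pairs of sequences as above (with the same $m$), with Jacobi operators $H_1,H_2$ and Weyl–Titchmarsh matrices $M_1,M_2$, and $M_1(z,k_0)=M_2(z,k_0)$ for all $z\in\mathbb C_+$, then $H_1=H_2$, and $A_1(k)=A_2(k)$ and $B_1(k)=B_2(k)$ for all $k\in\mathbb Z$. -/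

import Mathlib

open scoped Matrix Matrix.Norms.L2Operator ComplexOrder

/-- Coefficients of a bounded matrix-valued Jacobi operator: two sequences of self-adjoint complex
`m × m` matrices indexed by `ℤ`, with `A k` positive definite, uniformly bounded in operator
norm. -/
structure JacobiCoeffs (m : ℕ) where
  A : ℤ → Matrix (Fin m) (Fin m) ℂ
  B : ℤ → Matrix (Fin m) (Fin m) ℂ
  A_posDef : ∀ k, (A k).PosDef
  B_selfAdjoint : ∀ k, (B k).IsHermitian
  bounded : ∃ C : ℝ, 0 < C ∧ ∀ k, ‖A k‖ + ‖B k‖ ≤ C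

/-- The Hilbert space `ℓ²(ℤ)^m`, realized as the square-summable sequences `ℤ → ℂ^m`. -/
abbrev EllTwo (m : ℕ) : Type := lp (fun _ : ℤ => EuclideanSpace ℂ (Fin m)) 2

namespace EllTwo

variable {m : ℕ}

theorem memlp_shift (j : ℤ) (f : EllTwo m) :
    Memℓp (fun k : ℤ => f (k + j)) 2 := by
  have hp : 0 < (2 : ENNReal).toReal := by norm_num
  have h := (lp.memℓp f).summable hp
  exact (memℓp_gen_iff hp).2 (h.comp_injective (add_left_injective j))

/-- The shift `(shift j f)(k) = f (k + j)` on `ℓ²(ℤ)^m`. -/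
noncomputable def shift (j : ℤ) : EllTwo m →L[ℂ] EllTwo m :=
  LinearMap.mkContinuous
    { toFun := fun f => ⟨fun k => f (k + j), memlp_shift j f⟩
      map_add' := fun _ _ => rfl
      map_smul' := fun _ _ => rfl }
    1
    (fun f => by
      have hp : 0 < (2 : ENNReal).toReal := by norm_num
      rw [one_mul]
      refine lp.norm_le_of_tsum_le hp (norm_nonneg f) ?_
      rw [lp.norm_rpow_eq_tsum hp f]
      exact ((Equiv.addRight j).tsum_eq (fun k => ‖f k‖ ^ (2 : ENNReal).toReal)).le)

/-- Multiplication of `f` by a uniformly bounded sequence of matrices, `k ↦ T k (f k)`. -/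
noncomputable def mulOp (T : ℤ → Matrix (Fin m) (Fin m) ℂ) {C : ℝ} (hC : 0 ≤ C)
    (hT : ∀ k, ‖T k‖ ≤ C) : EllTwo m →L[ℂ] EllTwo m :=
  lp.mapCLM 2 (fun k => Matrix.toEuclideanCLM (n := Fin m) (𝕜 := ℂ) (T k)) hC hT

theorem shift_apply (j : ℤ) (f : EllTwo m) (k : ℤ) : shift j f k = f (k + j) := rfl

theorem mulOp_apply (T : ℤ → Matrix (Fin m) (Fin m) ℂ) {C : ℝ} (hC : 0 ≤ C)
    (hT : ∀ k, ‖T k‖ ≤ C) (f : EllTwo m) (k : ℤ) :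
    (mulOp T hC hT f k).ofLp = T k *ᵥ (f k).ofLp := rfl

end EllTwo

namespace JacobiCoeffs

variable {m : ℕ} (J : JacobiCoeffs m)

/-- A uniform bound on the coefficients. -/
noncomputable def bound : ℝ := J.bounded.choose

theorem bound_nonneg : 0 ≤ J.bound := J.bounded.choose_spec.1.le

theorem norm_A_le (k : ℤ) : ‖J.A k‖ ≤ J.bound :=
  (le_add_of_nonneg_right (norm_nonneg _)).trans (J.bounded.choose_spec.2 k)

theorem norm_B_le (k : ℤ) : ‖J.B k‖ ≤ J.bound :=
  (le_add_of_nonneg_left (norm_nonneg _)).trans (J.bounded.choose_spec.2 k)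

/-- The Jacobi operator `H = A S⁺ + A⁻ S⁻ + B` as a bounded operator on all of `ℓ²(ℤ)^m`. -/
noncomputable def H : EllTwo m →L[ℂ] EllTwo m :=
  (EllTwo.mulOp J.A J.bound_nonneg J.norm_A_le).comp (EllTwo.shift 1)
    + (EllTwo.mulOp (fun k => J.A (k - 1)) J.bound_nonneg (fun k => J.norm_A_le (k - 1))).comp
        (EllTwo.shift (-1))
    + EllTwo.mulOp J.B J.bound_nonneg J.norm_B_le

theorem H_apply (f : EllTwo m) (k : ℤ) :
    (J.H f k).ofLp = J.A k *ᵥ (f (k + 1)).ofLp + J.A (k - 1) *ᵥ (f (k - 1)).ofLp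
      + J.B k *ᵥ (f k).ofLp := by
  simp [H, EllTwo.mulOp_apply, EllTwo.shift_apply, sub_eq_add_neg]

/-- `ψ` is an `m × m` matrix-valued solution of the Jacobi difference equation
`A(k) ψ(k+1) + A(k-1) ψ(k-1) + (B(k) - z) ψ(k) = 0`. -/
def IsSolution (z : ℂ) (ψ : ℤ → Matrix (Fin m) (Fin m) ℂ) : Prop :=
  ∀ k : ℤ, J.A k * ψ (k + 1) + J.A (k - 1) * ψ (k - 1)
    + (J.B k - z • (1 : Matrix (Fin m) (Fin m) ℂ)) * ψ k = 0

/-- `(ψ k, ψ (k + 1)) ↦ (ψ (k + 1), ψ (k + 2))` for solutions `ψ`. -/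
noncomputable def stepRight (z : ℂ) (k : ℤ)
    (P : Matrix (Fin m) (Fin m) ℂ × Matrix (Fin m) (Fin m) ℂ) :
    Matrix (Fin m) (Fin m) ℂ × Matrix (Fin m) (Fin m) ℂ :=
  (P.2, (J.A (k + 1))⁻¹ *
    ((z • (1 : Matrix (Fin m) (Fin m) ℂ) - J.B (k + 1)) * P.2 - J.A k * P.1))

/-- `(ψ k, ψ (k + 1)) ↦ (ψ (k - 1), ψ k)` for solutions `ψ`. -/
noncomputable def stepLeft (z : ℂ) (k : ℤ)
    (P : Matrix (Fin m) (Fin m) ℂ × Matrix (Fin m) (Fin m) ℂ) :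
    Matrix (Fin m) (Fin m) ℂ × Matrix (Fin m) (Fin m) ℂ :=
  ((J.A (k - 1))⁻¹ *
    ((z • (1 : Matrix (Fin m) (Fin m) ℂ) - J.B k) * P.1 - J.A k * P.2), P.1)

/-- The pair `(ψ (k₀ + n), ψ (k₀ + n + 1))` for the solution with `ψ k₀ = X`,
`ψ (k₀ + 1) = Y`. -/
noncomputable def pairRight (z : ℂ) (k₀ : ℤ) (X Y : Matrix (Fin m) (Fin m) ℂ) :
    ℕ → Matrix (Fin m) (Fin m) ℂ × Matrix (Fin m) (Fin m) ℂ
  | 0 => (X, Y)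
  | n + 1 => J.stepRight z (k₀ + n) (pairRight z k₀ X Y n)

/-- The pair `(ψ (k₀ - n), ψ (k₀ - n + 1))` for the solution with `ψ k₀ = X`,
`ψ (k₀ + 1) = Y`. -/
noncomputable def pairLeft (z : ℂ) (k₀ : ℤ) (X Y : Matrix (Fin m) (Fin m) ℂ) :
    ℕ → Matrix (Fin m) (Fin m) ℂ × Matrix (Fin m) (Fin m) ℂ
  | 0 => (X, Y)
  | n + 1 => J.stepLeft z (k₀ - n) (pairLeft z k₀ X Y n)

/-- The solution of the difference equation with `ψ k₀ = X` and `ψ (k₀ + 1) = Y`. -/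
noncomputable def sol (z : ℂ) (k₀ : ℤ) (X Y : Matrix (Fin m) (Fin m) ℂ) (k : ℤ) :
    Matrix (Fin m) (Fin m) ℂ :=
  if k₀ ≤ k then (J.pairRight z k₀ X Y (k - k₀).toNat).1
  else (J.pairLeft z k₀ X Y (k₀ - k).toNat).1

section sol

variable (z : ℂ) (k₀ : ℤ) (X Y : Matrix (Fin m) (Fin m) ℂ)

theorem sol_right (n : ℕ) : J.sol z k₀ X Y (k₀ + n) = (J.pairRight z k₀ X Y n).1 := by
  simp [sol]

theorem sol_left (n : ℕ) : J.sol z k₀ X Y (k₀ - n) = (J.pairLeft z k₀ X Y n).1 := by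
  rcases n with _ | n
  · simp [sol, pairRight, pairLeft]
  · have h1 : ¬ k₀ ≤ k₀ - ((n + 1 : ℕ) : ℤ) := by push_cast; omega
    have h2 : (k₀ - (k₀ - ((n + 1 : ℕ) : ℤ))).toNat = n + 1 := by push_cast; omega
    rw [sol, if_neg h1, h2]

theorem sol_self : J.sol z k₀ X Y k₀ = X := by
  simp [sol, pairRight]

theorem sol_succ : J.sol z k₀ X Y (k₀ + 1) = Y := by
  have h := J.sol_right z k₀ X Y 1
  simpa [pairRight, stepRight] using h

theorem A_mul_inv (k : ℤ) (P : Matrix (Fin m) (Fin m) ℂ) :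
    J.A k * ((J.A k)⁻¹ * P) = P :=
  Matrix.mul_nonsing_inv_cancel_left _ _
    ((Matrix.isUnit_iff_isUnit_det _).1 (J.A_posDef k).isUnit)

theorem sol_isSolution : J.IsSolution z (J.sol z k₀ X Y) := by
  intro k
  rcases le_or_gt (k₀ + 1) k with hk | hk
  · obtain ⟨n, rfl⟩ : ∃ n : ℕ, k = k₀ + n + 1 := ⟨(k - k₀ - 1).toNat, by omega⟩
    have e0 : J.sol z k₀ X Y (k₀ + n + 1 - 1) = (J.pairRight z k₀ X Y n).1 := by
      rw [add_sub_cancel_right, sol_right]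
    have e1 : J.sol z k₀ X Y (k₀ + n + 1) = (J.pairRight z k₀ X Y n).2 := by
      have h := J.sol_right z k₀ X Y (n + 1)
      rw [show k₀ + ((n + 1 : ℕ) : ℤ) = k₀ + n + 1 by push_cast; ring] at h
      rw [h]; rfl
    have e2 : J.sol z k₀ X Y (k₀ + n + 1 + 1) = (J.pairRight z k₀ X Y (n + 1)).2 := by
      have h := J.sol_right z k₀ X Y (n + 2)
      rw [show k₀ + ((n + 2 : ℕ) : ℤ) = k₀ + n + 1 + 1 by push_cast; ring] at h
      rw [h]; rfl
    rw [e0, e1, e2, pairRight, stepRight]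
    simp only [A_mul_inv, add_sub_cancel_right]
    noncomm_ring
  · obtain ⟨n, rfl⟩ : ∃ n : ℕ, k = k₀ - n := ⟨(k₀ - k).toNat, by omega⟩
    have e0 : J.sol z k₀ X Y (k₀ - n - 1) = (J.pairLeft z k₀ X Y (n + 1)).1 := by
      rw [← sol_left]; congr 1; push_cast; ring
    have e1 : J.sol z k₀ X Y (k₀ - n + 1) = (J.pairLeft z k₀ X Y n).2 := by
      rcases n with _ | n
      · simpa [pairLeft] using J.sol_succ z k₀ X Y
      · have h := J.sol_left z k₀ X Y n
        rw [show k₀ - ((n + 1 : ℕ) : ℤ) + 1 = k₀ - n by push_cast; ring, h]; rfl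
    rw [e0, e1, sol_left, pairLeft, stepLeft]
    simp only [A_mul_inv]
    noncomm_ring

end sol

/-- The fundamental solution with `θ(z,k₀,k₀) = I`, `θ(z,k₀+1,k₀) = 0`. -/
noncomputable def theta (z : ℂ) (k k₀ : ℤ) : Matrix (Fin m) (Fin m) ℂ := J.sol z k₀ 1 0 k

/-- The fundamental solution with `φ(z,k₀,k₀) = 0`, `φ(z,k₀+1,k₀) = I`. -/
noncomputable def phi (z : ℂ) (k k₀ : ℤ) : Matrix (Fin m) (Fin m) ℂ := J.sol z k₀ 0 1 k

/-- The solution `θ - φ A(k₀)⁻¹ M`. -/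
noncomputable def weylSol (z : ℂ) (k₀ : ℤ) (M : Matrix (Fin m) (Fin m) ℂ) (k : ℤ) :
    Matrix (Fin m) (Fin m) ℂ :=
  J.theta z k k₀ - J.phi z k k₀ * (J.A k₀)⁻¹ * M

/-- The requirement that singles out `M₊(z,k₀)`: `θ - φ A(k₀)⁻¹ M` is square summable on
`(k₀, ∞) ∩ ℤ`. -/
def IsWeylPlus (z : ℂ) (k₀ : ℤ) (M : Matrix (Fin m) (Fin m) ℂ) : Prop :=
  Memℓp (fun k : Set.Ioi k₀ => J.weylSol z k₀ M k) 2

/-- The requirement that singles out `M₋(z,k₀)`: `θ - φ A(k₀)⁻¹ M` is square summable on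
`(-∞, k₀) ∩ ℤ`. -/
def IsWeylMinus (z : ℂ) (k₀ : ℤ) (M : Matrix (Fin m) (Fin m) ℂ) : Prop :=
  Memℓp (fun k : Set.Iio k₀ => J.weylSol z k₀ M k) 2

open Classical in
/-- The half-line Weyl-Titchmarsh matrix `M₊(z,k₀)`: the unique matrix satisfying `IsWeylPlus`.
The default value is never used for `z ∉ ℝ`, by the limit point property. -/
noncomputable def MPlus (z : ℂ) (k₀ : ℤ) : Matrix (Fin m) (Fin m) ℂ :=
  if h : ∃! M, J.IsWeylPlus z k₀ M then h.choose else 0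

open Classical in
/-- The half-line Weyl-Titchmarsh matrix `M₋(z,k₀)`: the unique matrix satisfying `IsWeylMinus`.
The default value is never used for `z ∉ ℝ`, by the limit point property. -/
noncomputable def MMinus (z : ℂ) (k₀ : ℤ) : Matrix (Fin m) (Fin m) ℂ :=
  if h : ∃! M, J.IsWeylMinus z k₀ M then h.choose else 0

/-- The `2m × 2m` Weyl-Titchmarsh matrix `M(z,k₀)`, in `m × m` blocks. For `z ∉ ℝ` the matrix
`M₋ - M₊` is invertible, and the lower right block is also `M₋ (M₋ - M₊)⁻¹ M₊`. -/
noncomputable def weylM (z : ℂ) (k₀ : ℤ) : Matrix (Fin m ⊕ Fin m) (Fin m ⊕ Fin m) ℂ :=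
  Matrix.fromBlocks
    (J.MMinus z k₀ - J.MPlus z k₀)⁻¹
    ((2 : ℂ)⁻¹ • ((J.MMinus z k₀ - J.MPlus z k₀)⁻¹ * (J.MMinus z k₀ + J.MPlus z k₀)))
    ((2 : ℂ)⁻¹ • ((J.MMinus z k₀ + J.MPlus z k₀) * (J.MMinus z k₀ - J.MPlus z k₀)⁻¹))
    (J.MPlus z k₀ * (J.MMinus z k₀ - J.MPlus z k₀)⁻¹ * J.MMinus z k₀)

end JacobiCoeffs

/-!
Once `‖z‖` exceeds three times a bound for the coefficients, the difference equation on a half-line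
is a contraction on bounded sequences: a bounded solution exists, is determined by its boundary
value and decays geometrically. Hence `M₊(z, k)` exists, tends to `0` as `z → ∞`, and satisfies a
Riccati equation linking it to `M₊(z, k + 1)`. Consequently `z M₊(z, k) → -A(k)²`, so `M₊(·, k)`
determines `A(k)` as a positive square root, then `M₊(·, k + 1) - B(k + 1)` by the Riccati equation,
and then `B(k + 1)` as a limit; inductively it determines all coefficients to the right of `k`.
Moreover `M₋(z, k) = B(k) - z - M₊(z, -k)`, where `M₊` on the right belongs to the reversed lattice,
which gives the coefficients to the left. Finally `M₋ - M₊ = -z + O(1)` is invertible for large `z`,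
so `M₋` and `M₊` can be read off from the first two blocks of `M`. All of this uses `z` only along a
sequence tending to infinity.
-/

open Filter Topology Bornology

section DifferenceExpression

variable {𝕜 R : Type*} [CommSemiring 𝕜] [Ring R] [Algebra 𝕜 R] {a b ψ χ : ℤ → R} {z : 𝕜}
  {k₀ k₁ : ℤ}

/-- The formal Jacobi difference expression with coefficients `a`, `b` in a ring, applied to an
arbitrary two-sided sequence `ψ`. -/
def jacobiExpr (a b ψ : ℤ → R) (k : ℤ) : R :=
  a k * ψ (k + 1) + a (k - 1) * ψ (k - 1) + b k * ψ k

theorem jacobiExpr_sub (a b ψ χ : ℤ → R) (k : ℤ) :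
    jacobiExpr a b (ψ - χ) k = jacobiExpr a b ψ k - jacobiExpr a b χ k := by
  simp only [jacobiExpr, Pi.sub_apply]
  noncomm_ring

theorem jacobiExpr_mul_right (a b ψ : ℤ → R) (x : R) (k : ℤ) :
    jacobiExpr a b (fun j => ψ j * x) k = jacobiExpr a b ψ k * x := by
  simp only [jacobiExpr, add_mul, mul_assoc]

theorem jacobiExpr_reflect (a b ψ : ℤ → R) (k : ℤ) :
    jacobiExpr (fun j => a (-j - 1)) (fun j => b (-j)) (fun j => ψ (-j)) k
      = jacobiExpr a b ψ (-k) := by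
  simp only [jacobiExpr, neg_add, neg_sub', sub_neg_eq_add, add_sub_cancel_right,
    ← sub_eq_add_neg]
  abel

/-- `ψ` solves the Jacobi difference equation with spectral parameter `z` at all sites to the right
of `k₀`. The value `ψ k₀` enters as boundary data, the values further left are irrelevant. -/
def IsRightSolution (a b : ℤ → R) (z : 𝕜) (k₀ : ℤ) (ψ : ℤ → R) : Prop :=
  ∀ k, k₀ < k → jacobiExpr a b ψ k = z • ψ k

namespace IsRightSolution

theorem mono (hψ : IsRightSolution a b z k₀ ψ) (hk : k₀ ≤ k₁) : IsRightSolution a b z k₁ ψ :=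
  fun k h => hψ k (hk.trans_lt h)

theorem sub (hψ : IsRightSolution a b z k₀ ψ) (hχ : IsRightSolution a b z k₀ χ) :
    IsRightSolution a b z k₀ (ψ - χ) := fun k hk => by
  rw [jacobiExpr_sub, hψ k hk, hχ k hk, Pi.sub_apply, smul_sub]

theorem mul_right (hψ : IsRightSolution a b z k₀ ψ) (x : R) :
    IsRightSolution a b z k₀ (fun k => ψ k * x) := fun k hk => by
  rw [jacobiExpr_mul_right, hψ k hk, smul_mul_assoc]

theorem eqOn_of_eq_of_succ_eq (ha : ∀ k, IsUnit (a k)) (hψ : IsRightSolution a b z k₀ ψ)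
    (hχ : IsRightSolution a b z k₀ χ) (h₀ : ψ k₀ = χ k₀) (h₁ : ψ (k₀ + 1) = χ (k₀ + 1)) :
    Set.EqOn ψ χ (Set.Ici k₀) := by
  suffices h : ∀ k, k₀ ≤ k → ψ k = χ k ∧ ψ (k + 1) = χ (k + 1) from fun k hk => (h k hk).1
  intro k hk
  induction k, hk using Int.leInduction with
  | base => exact ⟨h₀, h₁⟩
  | succ k hk ih =>
    have h : jacobiExpr a b ψ (k + 1) = jacobiExpr a b χ (k + 1) := by
      rw [hψ _ (Int.lt_add_one_of_le hk), hχ _ (Int.lt_add_one_of_le hk), ih.2]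
    simp only [jacobiExpr, add_sub_cancel_right, ih.1, ih.2, add_left_inj] at h
    exact ⟨ih.2, (ha _).mul_right_inj.1 h⟩

end IsRightSolution

end DifferenceExpression

section LargeSpectralParameter

variable {𝕜 R : Type*} [NormedField 𝕜] [NormedRing R] [NormedAlgebra 𝕜 R] {a b ψ χ : ℤ → R}
  {C : ℝ} {z : 𝕜} {k₀ : ℤ}

theorem norm_inv_smul_jacobiExpr_le (ha : ∀ k, ‖a k‖ ≤ C) (hb : ∀ k, ‖b k‖ ≤ C) (z : 𝕜) {S : ℝ}
    {k : ℤ} (hψ : ∀ j, k - 1 ≤ j → ‖ψ j‖ ≤ S) :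
    ‖z⁻¹ • jacobiExpr a b ψ k‖ ≤ 3 * C / ‖z‖ * S := by
  have hmul {x y : R} (hx : ‖x‖ ≤ C) (hy : ‖y‖ ≤ S) : ‖x * y‖ ≤ C * S :=
    norm_mul_le_of_le hx hy
  have hexpr : ‖jacobiExpr a b ψ k‖ ≤ 3 * C * S := by
    refine norm_add₃_le.trans ?_
    linarith [hmul (ha k) (hψ (k + 1) (by lia)), hmul (ha (k - 1)) (hψ (k - 1) le_rfl),
      hmul (hb k) (hψ k (by lia))]
  calc ‖z⁻¹ • jacobiExpr a b ψ k‖ = ‖z‖⁻¹ * ‖jacobiExpr a b ψ k‖ := by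
        rw [norm_smul, norm_inv]
    _ ≤ ‖z‖⁻¹ * (3 * C * S) := by gcongr
    _ = 3 * C / ‖z‖ * S := by ring

namespace IsRightSolution

theorem norm_le_of_bddAbove (ha : ∀ k, ‖a k‖ ≤ C) (hb : ∀ k, ‖b k‖ ≤ C) (hz : 3 * C < ‖z‖)
    (hψ : IsRightSolution a b z k₀ ψ) (hbdd : BddAbove ((‖ψ ·‖) '' Set.Ici k₀)) {k : ℤ}
    (hk : k₀ < k) : ‖ψ k‖ ≤ 3 * C / ‖z‖ * ‖ψ k₀‖ := by
  have hC : 0 ≤ C := (norm_nonneg _).trans (ha 0)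
  have hz_pos : 0 < ‖z‖ := by linarith
  have hq : 3 * C / ‖z‖ < 1 := (div_lt_one hz_pos).2 hz
  set S := sSup ((‖ψ ·‖) '' Set.Ici k₀)
  have hle {j : ℤ} (hj : k₀ ≤ j) : ‖ψ j‖ ≤ S := le_csSup hbdd (Set.mem_image_of_mem _ hj)
  have hcontr {j : ℤ} (hj : k₀ < j) : ‖ψ j‖ ≤ 3 * C / ‖z‖ * S := by
    rw [← inv_smul_smul₀ (norm_pos_iff.1 hz_pos) (ψ j), ← hψ j hj]
    exact norm_inv_smul_jacobiExpr_le ha hb z fun i hi => hle (by lia)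
  have hS : S ≤ max ‖ψ k₀‖ (3 * C / ‖z‖ * S) := by
    refine csSup_le (Set.nonempty_Ici.image _) (Set.forall_mem_image.2 fun j hj => ?_)
    rcases (Set.mem_Ici.1 hj).eq_or_lt with rfl | hj
    · exact le_max_left _ _
    · exact (hcontr hj).trans (le_max_right _ _)
  have hS_le : S ≤ ‖ψ k₀‖ := by
    refine (le_max_iff.1 hS).elim id fun h => ?_
    nlinarith [norm_nonneg (ψ k₀)]
  exact (hcontr hk).trans (by gcongr)

theorem norm_add_natCast_le_pow (ha : ∀ k, ‖a k‖ ≤ C) (hb : ∀ k, ‖b k‖ ≤ C) (hz : 3 * C < ‖z‖)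
    (hψ : IsRightSolution a b z k₀ ψ) (hbdd : BddAbove ((‖ψ ·‖) '' Set.Ici k₀)) (n : ℕ) :
    ‖ψ (k₀ + n)‖ ≤ (3 * C / ‖z‖) ^ n * ‖ψ k₀‖ := by
  have hC : 0 ≤ C := (norm_nonneg _).trans (ha 0)
  induction n with
  | zero => simp
  | succ n ih =>
    have hn : k₀ ≤ k₀ + n := by lia
    calc ‖ψ (k₀ + (n + 1 : ℕ))‖ ≤ 3 * C / ‖z‖ * ‖ψ (k₀ + n)‖ :=
          (hψ.mono hn).norm_le_of_bddAbove ha hb hz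
            (hbdd.mono (Set.image_mono (Set.Ici_subset_Ici.2 hn))) (by lia)
      _ ≤ 3 * C / ‖z‖ * ((3 * C / ‖z‖) ^ n * ‖ψ k₀‖) := by gcongr
      _ = (3 * C / ‖z‖) ^ (n + 1) * ‖ψ k₀‖ := by ring

theorem memℓp_two (ha : ∀ k, ‖a k‖ ≤ C) (hb : ∀ k, ‖b k‖ ≤ C) (hz : 3 * C < ‖z‖)
    (hψ : IsRightSolution a b z k₀ ψ) (hbdd : BddAbove ((‖ψ ·‖) '' Set.Ici k₀)) :
    Memℓp (fun k : Set.Ioi k₀ => ψ k) 2 := by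
  have hC : 0 ≤ C := (norm_nonneg _).trans (ha 0)
  have hq : 3 * C / ‖z‖ < 1 := (div_lt_one (by linarith)).2 hz
  let i : Set.Ioi k₀ → ℕ := fun k => (k - k₀).toNat
  have hi (k : Set.Ioi k₀) : k₀ + i k = k := by
    have := Set.mem_Ioi.1 k.2
    lia
  have hi_inj : Function.Injective i := fun k l h => Subtype.ext (by rw [← hi k, ← hi l, h])
  refine (memℓp_gen (p := 1) ?_).of_exponent_ge one_le_two
  simp only [ENNReal.toReal_one, Real.rpow_one]
  refine Summable.of_nonneg_of_le (fun k => norm_nonneg _) (fun k => ?_)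
    (((summable_geometric_of_lt_one (by positivity) hq).comp_injective hi_inj).mul_right ‖ψ k₀‖)
  have h := hψ.norm_add_natCast_le_pow ha hb hz hbdd (i k)
  rwa [hi] at h

theorem eqOn_of_bddAbove (ha : ∀ k, ‖a k‖ ≤ C) (hb : ∀ k, ‖b k‖ ≤ C) (hz : 3 * C < ‖z‖)
    (hψ : IsRightSolution a b z k₀ ψ) (hχ : IsRightSolution a b z k₀ χ)
    (hψ_bdd : BddAbove ((‖ψ ·‖) '' Set.Ici k₀)) (hχ_bdd : BddAbove ((‖χ ·‖) '' Set.Ici k₀))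
    (h₀ : ψ k₀ = χ k₀) : Set.EqOn ψ χ (Set.Ici k₀) := by
  intro k hk
  rcases (Set.mem_Ici.1 hk).eq_or_lt with rfl | hk
  · exact h₀
  obtain ⟨S, hS⟩ := hψ_bdd
  obtain ⟨T, hT⟩ := hχ_bdd
  have hbdd : BddAbove ((‖(ψ - χ) ·‖) '' Set.Ici k₀) :=
    ⟨S + T, Set.forall_mem_image.2 fun j hj => norm_sub_le_of_le
      (hS (Set.mem_image_of_mem _ hj)) (hT (Set.mem_image_of_mem _ hj))⟩
  have h := (hψ.sub hχ).norm_le_of_bddAbove ha hb hz hbdd hk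
  rwa [Pi.sub_apply, Pi.sub_apply, h₀, sub_self, norm_zero, mul_zero, norm_le_zero_iff,
    sub_eq_zero] at h

end IsRightSolution

open scoped BoundedContinuousFunction in
/-- The self-map of the bounded sequences whose fixed points are the bounded solutions to the right
of `k₀` with boundary value `x` (extended by the constant `x` to the left of `k₀`). -/
noncomputable def jacobiFixedPointMap (ha : ∀ k, ‖a k‖ ≤ C) (hb : ∀ k, ‖b k‖ ≤ C) (z : 𝕜)
    (k₀ : ℤ) (x : R) (u : ℤ →ᵇ R) : ℤ →ᵇ R :=
  .ofNormedAddCommGroupDiscrete (fun k => if k₀ < k then z⁻¹ • jacobiExpr a b u k else x)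
    (max (3 * C / ‖z‖ * ‖u‖) ‖x‖) fun k => by
      split_ifs
      · exact le_max_of_le_left
          (norm_inv_smul_jacobiExpr_le ha hb z fun j _ => u.norm_coe_le_norm j)
      · exact le_max_right _ _

theorem contractingWith_jacobiFixedPointMap (ha : ∀ k, ‖a k‖ ≤ C) (hb : ∀ k, ‖b k‖ ≤ C)
    (hz : 3 * C < ‖z‖) (k₀ : ℤ) (x : R) :
    ContractingWith (3 * C / ‖z‖).toNNReal (jacobiFixedPointMap ha hb z k₀ x) := by
  have hC : 0 ≤ C := (norm_nonneg _).trans (ha 0)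
  have hq : 3 * C / ‖z‖ < 1 := (div_lt_one (by linarith)).2 hz
  refine ⟨Real.toNNReal_lt_one.2 hq, LipschitzWith.of_dist_le_mul fun u v => ?_⟩
  rw [Real.coe_toNNReal _ (by positivity), BoundedContinuousFunction.dist_le (by positivity)]
  intro k
  simp only [jacobiFixedPointMap, BoundedContinuousFunction.coe_ofNormedAddCommGroupDiscrete]
  split_ifs
  · rw [dist_eq_norm, ← smul_sub, ← jacobiExpr_sub]
    refine norm_inv_smul_jacobiExpr_le ha hb z fun j _ => ?_
    rw [Pi.sub_apply, ← dist_eq_norm]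
    exact BoundedContinuousFunction.dist_coe_le_dist j
  · rw [dist_self]
    positivity

theorem exists_isRightSolution_bddAbove [CompleteSpace R] (ha : ∀ k, ‖a k‖ ≤ C)
    (hb : ∀ k, ‖b k‖ ≤ C) (hz : 3 * C < ‖z‖) (k₀ : ℤ) (x : R) :
    ∃ ψ, IsRightSolution a b z k₀ ψ ∧ ψ k₀ = x ∧ BddAbove ((‖ψ ·‖) '' Set.Ici k₀) := by
  have hC : 0 ≤ C := (norm_nonneg _).trans (ha 0)
  have hz₀ : z ≠ 0 := norm_pos_iff.1 (by linarith)
  have hF := contractingWith_jacobiFixedPointMap ha hb hz k₀ x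
  let u := hF.fixedPoint
  have hu (k : ℤ) : (if k₀ < k then z⁻¹ • jacobiExpr a b u k else x) = u k :=
    DFunLike.congr_fun hF.fixedPoint_isFixedPt k
  refine ⟨u, fun k hk => ?_, ?_, ‖u‖, Set.forall_mem_image.2 fun k _ => u.norm_coe_le_norm k⟩
  · rw [← hu k, if_pos hk, smul_inv_smul₀ hz₀]
  · rw [← hu k₀, if_neg (lt_irrefl k₀)]

theorem eventually_isUnit_sub_smul_one [CompleteSpace R] {l : Filter 𝕜} (hl : l ≤ cobounded 𝕜)
    {Y : 𝕜 → R} {y : R} (hY : Tendsto Y l (𝓝 y)) : ∀ᶠ z in l, IsUnit (Y z - z • (1 : R)) := by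
  have hlim : Tendsto (fun z => z⁻¹ • Y z - 1) l (𝓝 ((-1 : Rˣ) : R)) := by
    simpa using ((tendsto_inv₀_cobounded.mono_left hl).smul hY).sub_const 1
  filter_upwards [hlim.eventually (Units.nhds (-1)), hl (eventually_ne_cobounded 0)] with z hunit hz
  have hscale : Y z - z • (1 : R) = Units.mk0 z hz • (z⁻¹ • Y z - 1) := by
    rw [Units.smul_mk0, smul_sub, smul_inv_smul₀ hz]
  rw [hscale]
  exact IsUnit.smul _ hunit

end LargeSpectralParameter

open scoped MatrixOrder in
theorem eq_of_mul_self_eq_of_posDef {n 𝕜 : Type*} [Fintype n] [RCLike 𝕜]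
    {P Q : Matrix n n 𝕜} (hP : P.PosDef) (hQ : Q.PosDef) (h : P * P = Q * Q) : P = Q := by
  classical
  rw [← CFC.sqrt_mul_self P hP.posSemidef.nonneg, h, CFC.sqrt_mul_self Q hQ.posSemidef.nonneg]

namespace JacobiCoeffs

variable {m : ℕ} {J J' : JacobiCoeffs m} {z : ℂ} {k₀ k : ℤ} {M : Matrix (Fin m) (Fin m) ℂ}
  {l : Filter ℂ}

@[ext]
theorem ext_coeffs (hA : ∀ k, J.A k = J'.A k) (hB : ∀ k, J.B k = J'.B k) : J = J' := by
  cases J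
  cases J'
  congr
  · exact funext hA
  · exact funext hB

theorem isUnit_A (J : JacobiCoeffs m) (k : ℤ) : IsUnit (J.A k) := (J.A_posDef k).isUnit

theorem eventually_three_mul_bound_lt_norm (J : JacobiCoeffs m) (hl : l ≤ cobounded ℂ) :
    ∀ᶠ z in l, 3 * J.bound < ‖z‖ :=
  hl (tendsto_norm_cobounded_atTop.eventually_gt_atTop _)

theorem isSolution_iff {ψ : ℤ → Matrix (Fin m) (Fin m) ℂ} :
    J.IsSolution z ψ ↔ ∀ k, jacobiExpr J.A J.B ψ k = z • ψ k := by
  refine forall_congr' fun k => ?_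
  rw [sub_mul, smul_one_mul, ← add_sub_assoc, sub_eq_zero, jacobiExpr]

theorem weylSol_isSolution (J : JacobiCoeffs m) (z : ℂ) (k₀ : ℤ)
    (M : Matrix (Fin m) (Fin m) ℂ) : J.IsSolution z (J.weylSol z k₀ M) := by
  have hθ := isSolution_iff.1 (J.sol_isSolution z k₀ 1 0)
  have hφ := isSolution_iff.1 (J.sol_isSolution z k₀ 0 1)
  have hsol : J.weylSol z k₀ M
      = J.sol z k₀ 1 0 - fun k => J.sol z k₀ 0 1 k * ((J.A k₀)⁻¹ * M) := by
    funext k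
    simp only [weylSol, theta, phi, Pi.sub_apply, mul_assoc]
  refine isSolution_iff.2 fun k => ?_
  rw [hsol, jacobiExpr_sub, jacobiExpr_mul_right, hθ, hφ, Pi.sub_apply, smul_sub, smul_mul_assoc]

theorem weylSol_isRightSolution (J : JacobiCoeffs m) (z : ℂ) (k₀ : ℤ)
    (M : Matrix (Fin m) (Fin m) ℂ) : IsRightSolution J.A J.B z k₀ (J.weylSol z k₀ M) :=
  fun k _ => isSolution_iff.1 (J.weylSol_isSolution z k₀ M) k

theorem weylSol_self (J : JacobiCoeffs m) (z : ℂ) (k₀ : ℤ) (M : Matrix (Fin m) (Fin m) ℂ) :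
    J.weylSol z k₀ M k₀ = 1 := by
  simp [weylSol, theta, phi, sol_self]

theorem A_mul_weylSol_succ (J : JacobiCoeffs m) (z : ℂ) (k₀ : ℤ) (M : Matrix (Fin m) (Fin m) ℂ) :
    J.A k₀ * J.weylSol z k₀ M (k₀ + 1) = -M := by
  simp [weylSol, theta, phi, sol_succ, A_mul_inv]

theorem A_mul_weylSol_pred (J : JacobiCoeffs m) (z : ℂ) (k₀ : ℤ) (M : Matrix (Fin m) (Fin m) ℂ) :
    J.A (k₀ - 1) * J.weylSol z k₀ M (k₀ - 1) = M - (J.B k₀ - z • 1) := by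
  have h := J.weylSol_isSolution z k₀ M k₀
  rw [A_mul_weylSol_succ, weylSol_self, mul_one] at h
  linear_combination (norm := module) h

theorem eqOn_weylSol {ψ : ℤ → Matrix (Fin m) (Fin m) ℂ} (hψ : IsRightSolution J.A J.B z k₀ ψ)
    (h₀ : ψ k₀ = 1) (h₁ : J.A k₀ * ψ (k₀ + 1) = -M) :
    Set.EqOn ψ (J.weylSol z k₀ M) (Set.Ici k₀) := by
  refine hψ.eqOn_of_eq_of_succ_eq J.isUnit_A (J.weylSol_isRightSolution z k₀ M)
    (h₀.trans (J.weylSol_self z k₀ M).symm) ((J.isUnit_A k₀).mul_right_inj.1 ?_)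
  rw [h₁, A_mul_weylSol_succ]

theorem isWeylPlus_iff_bddAbove (hz : 3 * J.bound < ‖z‖) :
    J.IsWeylPlus z k₀ M ↔ BddAbove ((‖J.weylSol z k₀ M ·‖) '' Set.Ici k₀) := by
  refine ⟨fun h => ?_, (J.weylSol_isRightSolution z k₀ M).memℓp_two J.norm_A_le J.norm_B_le hz⟩
  have hIoi := memℓp_infty_iff.1 (Memℓp.of_exponent_ge h le_top)
  rw [← Set.Ioi_insert, Set.image_insert_eq, bddAbove_insert, Set.image_eq_range]
  exact hIoi

theorem existsUnique_isWeylPlus (hz : 3 * J.bound < ‖z‖) (k₀ : ℤ) :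
    ∃! M, J.IsWeylPlus z k₀ M := by
  obtain ⟨ψ, hψ, hψ₀, hψ_bdd⟩ := exists_isRightSolution_bddAbove J.norm_A_le J.norm_B_le hz k₀ 1
  have heq {M} (hM : J.A k₀ * ψ (k₀ + 1) = -M) := eqOn_weylSol hψ hψ₀ hM
  refine ⟨-(J.A k₀ * ψ (k₀ + 1)), (isWeylPlus_iff_bddAbove hz).2 ?_, fun M hM => ?_⟩
  · rwa [← Set.image_congr fun k hk => congrArg norm (heq (neg_neg _).symm hk)]
  · have h := (J.weylSol_isRightSolution z k₀ M).eqOn_of_bddAbove J.norm_A_le J.norm_B_le hz hψ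
      ((isWeylPlus_iff_bddAbove hz).1 hM) hψ_bdd ((J.weylSol_self z k₀ M).trans hψ₀.symm)
    rw [← h (Set.mem_Ici.2 (Int.le_add_one le_rfl)), A_mul_weylSol_succ, neg_neg]

theorem isWeylPlus_MPlus (hz : 3 * J.bound < ‖z‖) (k₀ : ℤ) :
    J.IsWeylPlus z k₀ (J.MPlus z k₀) := by
  rw [MPlus, dif_pos (existsUnique_isWeylPlus hz k₀)]
  exact (existsUnique_isWeylPlus hz k₀).choose_spec.1

theorem norm_MPlus_le (hz : 3 * J.bound < ‖z‖) (k₀ : ℤ) :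
    ‖J.MPlus z k₀‖ ≤ J.bound * (3 * J.bound / ‖z‖ * ‖(1 : Matrix (Fin m) (Fin m) ℂ)‖) := by
  have h := (J.weylSol_isRightSolution z k₀ (J.MPlus z k₀)).norm_le_of_bddAbove J.norm_A_le
    J.norm_B_le hz ((isWeylPlus_iff_bddAbove hz).1 (isWeylPlus_MPlus hz k₀)) (lt_add_one k₀)
  rw [weylSol_self] at h
  rw [← norm_neg, ← A_mul_weylSol_succ J z k₀]
  exact norm_mul_le_of_le (J.norm_A_le k₀) h

theorem tendsto_MPlus (J : JacobiCoeffs m) (hl : l ≤ cobounded ℂ) (k : ℤ) :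
    Tendsto (J.MPlus · k) l (𝓝 0) := by
  have hinv : Tendsto (fun z : ℂ => ‖z‖⁻¹) l (𝓝 0) :=
    (tendsto_inv_atTop_zero.comp tendsto_norm_cobounded_atTop).mono_left hl
  refine squeeze_zero_norm' ((J.eventually_three_mul_bound_lt_norm hl).mono
    fun z hz => norm_MPlus_le hz k) ?_
  simpa [div_eq_mul_inv] using ((hinv.const_mul (3 * J.bound)).mul_const
    ‖(1 : Matrix (Fin m) (Fin m) ℂ)‖).const_mul J.bound

theorem eqOn_weylSol_MPlus_succ (hz : 3 * J.bound < ‖z‖) (k : ℤ) :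
    Set.EqOn (J.weylSol z k (J.MPlus z k))
      (fun j => J.weylSol z (k + 1) (J.MPlus z (k + 1)) j * J.weylSol z k (J.MPlus z k) (k + 1))
      (Set.Ici (k + 1)) := by
  have hbdd (j : ℤ) := (isWeylPlus_iff_bddAbove hz).1 (isWeylPlus_MPlus (J := J) hz j)
  have hk : k ≤ k + 1 := Int.le_add_one le_rfl
  refine ((J.weylSol_isRightSolution z k _).mono hk).eqOn_of_bddAbove J.norm_A_le J.norm_B_le hz
    ((J.weylSol_isRightSolution z (k + 1) _).mul_right _)
    ((hbdd k).mono (Set.image_mono (Set.Ici_subset_Ici.2 hk))) ?_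
    (by rw [J.weylSol_self z (k + 1), one_mul])
  obtain ⟨S, hS⟩ := hbdd (k + 1)
  exact ⟨S * _, Set.forall_mem_image.2 fun j hj =>
    norm_mul_le_of_le (hS (Set.mem_image_of_mem _ hj)) le_rfl⟩

/-- The Riccati equation `z - B(k+1) + M₊(k+1) + A(k) M₊(k)⁻¹ A(k) = 0`, cleared of the inverse of
`M₊(k)`. -/
theorem riccati_MPlus (hz : 3 * J.bound < ‖z‖) (k : ℤ) :
    (z • 1 - J.B (k + 1) + J.MPlus z (k + 1)) * ((J.A k)⁻¹ * J.MPlus z k) = -J.A k := by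
  set ψ := J.weylSol z k (J.MPlus z k) with hψ
  have hψ_self : ψ k = 1 := J.weylSol_self z k _
  have hψ_succ : (J.A k)⁻¹ * J.MPlus z k = -ψ (k + 1) :=
    (J.isUnit_A k).mul_right_inj.1
      (by rw [A_mul_inv, mul_neg, hψ, A_mul_weylSol_succ, neg_neg])
  have hψ_succ_succ : J.A (k + 1) * ψ (k + 1 + 1) = -(J.MPlus z (k + 1) * ψ (k + 1)) := by
    rw [hψ, eqOn_weylSol_MPlus_succ hz k (Set.mem_Ici.2 (Int.le_add_one le_rfl)),
      ← mul_assoc, A_mul_weylSol_succ, neg_mul]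
  have hexpr : jacobiExpr J.A J.B ψ (k + 1) = z • ψ (k + 1) :=
    J.weylSol_isRightSolution z k _ (k + 1) (lt_add_one k)
  rw [jacobiExpr, hψ_succ_succ, add_sub_cancel_right, hψ_self, mul_one] at hexpr
  rw [hψ_succ, add_mul, sub_mul, smul_one_mul, smul_neg, ← hexpr]
  noncomm_ring

theorem tendsto_smul_MPlus (J : JacobiCoeffs m) (hl : l ≤ cobounded ℂ) (k : ℤ) :
    Tendsto (fun z => z • J.MPlus z k) l (𝓝 (-(J.A k * J.A k))) := by
  have hlim : Tendsto (fun z => -(J.A k * J.A k)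
      - J.A k * ((J.MPlus z (k + 1) - J.B (k + 1)) * ((J.A k)⁻¹ * J.MPlus z k))) l
      (𝓝 (-(J.A k * J.A k))) := by
    simpa using ((((J.tendsto_MPlus hl (k + 1)).sub_const (J.B (k + 1))).mul
      ((J.tendsto_MPlus hl k).const_mul (J.A k)⁻¹)).const_mul (J.A k)).const_sub
        (-(J.A k * J.A k))
  refine hlim.congr' ?_
  filter_upwards [J.eventually_three_mul_bound_lt_norm hl] with z hz
  have h := congrArg (J.A k * ·) (riccati_MPlus (J := J) hz k)
  simp only [add_mul, sub_mul, smul_one_mul, mul_add, mul_sub, mul_smul_comm, A_mul_inv,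
    mul_neg] at h ⊢
  rw [← h]
  abel

theorem isUnit_MPlus (hz : 3 * J.bound < ‖z‖) (k : ℤ) : IsUnit (J.MPlus z k) := by
  have h : IsUnit ((J.A k)⁻¹ * J.MPlus z k) :=
    isUnit_of_mul_isUnit_right (riccati_MPlus hz k ▸ (J.isUnit_A k).neg)
  exact isUnit_of_mul_isUnit_right h

theorem A_eq_of_eventually_MPlus_eq [l.NeBot] (hl : l ≤ cobounded ℂ)
    (h : ∀ᶠ z in l, J.MPlus z k = J'.MPlus z k) : J.A k = J'.A k := by
  have hlim := tendsto_nhds_unique_of_eventuallyEq (J.tendsto_smul_MPlus hl k)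
    (J'.tendsto_smul_MPlus hl k) (h.mono fun z hz => congrArg (z • ·) hz)
  exact eq_of_mul_self_eq_of_posDef (J.A_posDef k) (J'.A_posDef k) (neg_injective hlim)

theorem eventually_MPlus_succ_sub_B_eq [l.NeBot] (hl : l ≤ cobounded ℂ)
    (h : ∀ᶠ z in l, J.MPlus z k = J'.MPlus z k) :
    ∀ᶠ z in l, J.MPlus z (k + 1) - J.B (k + 1) = J'.MPlus z (k + 1) - J'.B (k + 1) := by
  filter_upwards [h, J.eventually_three_mul_bound_lt_norm hl,
    J'.eventually_three_mul_bound_lt_norm hl] with z hM hz hz'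
  have hric : (z • 1 - J.B (k + 1) + J.MPlus z (k + 1)) * ((J.A k)⁻¹ * J.MPlus z k)
      = (z • 1 - J'.B (k + 1) + J'.MPlus z (k + 1)) * ((J.A k)⁻¹ * J.MPlus z k) := by
    rw [riccati_MPlus hz k, hM, A_eq_of_eventually_MPlus_eq hl h, riccati_MPlus hz' k]
  have hunit : IsUnit ((J.A k)⁻¹ * J.MPlus z k) :=
    ((Matrix.isUnit_nonsing_inv_iff).2 (J.isUnit_A k)).mul (isUnit_MPlus hz k)
  linear_combination (norm := module) hunit.mul_left_inj.1 hric

theorem B_succ_eq_of_eventually_MPlus_eq [l.NeBot] (hl : l ≤ cobounded ℂ)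
    (h : ∀ᶠ z in l, J.MPlus z k = J'.MPlus z k) : J.B (k + 1) = J'.B (k + 1) := by
  have hlim := tendsto_nhds_unique_of_eventuallyEq
    ((J.tendsto_MPlus hl (k + 1)).sub_const (J.B (k + 1)))
    ((J'.tendsto_MPlus hl (k + 1)).sub_const (J'.B (k + 1))) (eventually_MPlus_succ_sub_B_eq hl h)
  simpa using hlim

theorem eventually_MPlus_eq_of_le [l.NeBot] (hl : l ≤ cobounded ℂ)
    (h : ∀ᶠ z in l, J.MPlus z k₀ = J'.MPlus z k₀) (hk : k₀ ≤ k) :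
    ∀ᶠ z in l, J.MPlus z k = J'.MPlus z k := by
  induction k, hk using Int.leInduction with
  | base => exact h
  | succ k _ ih =>
    filter_upwards [eventually_MPlus_succ_sub_B_eq hl ih] with z hz
    rwa [B_succ_eq_of_eventually_MPlus_eq hl ih, sub_left_inj] at hz

/-- The Jacobi coefficients obtained by reversing the lattice, `k ↦ -k`. Since `A k` couples the
sites `k` and `k + 1`, its index is shifted as well. -/
noncomputable def reflect (J : JacobiCoeffs m) : JacobiCoeffs m where
  A k := J.A (-k - 1)
  B k := J.B (-k)
  A_posDef k := J.A_posDef (-k - 1)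
  B_selfAdjoint k := J.B_selfAdjoint (-k)
  bounded := ⟨J.bound + J.bound, add_pos J.bounded.choose_spec.1 J.bounded.choose_spec.1,
    fun k => add_le_add (J.norm_A_le (-k - 1)) (J.norm_B_le (-k))⟩

theorem weylSol_neg (J : JacobiCoeffs m) (z : ℂ) (k₀ : ℤ) (M : Matrix (Fin m) (Fin m) ℂ) :
    Set.EqOn (fun k => J.weylSol z k₀ M (-k)) (J.reflect.weylSol z (-k₀) (J.B k₀ - z • 1 - M))
      (Set.Ici (-k₀)) := by
  refine eqOn_weylSol (fun k _ => ?_) ?_ ?_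
  · exact (jacobiExpr_reflect J.A J.B (J.weylSol z k₀ M) k).trans
      (isSolution_iff.1 (J.weylSol_isSolution z k₀ M) (-k))
  · rw [neg_neg, weylSol_self]
  · simpa [reflect, neg_add_eq_sub] using J.A_mul_weylSol_pred z k₀ M

theorem isWeylMinus_iff_reflect :
    J.IsWeylMinus z k₀ M ↔ J.reflect.IsWeylPlus z (-k₀) (J.B k₀ - z • 1 - M) := by
  let e : Set.Ioi (-k₀) ≃ Set.Iio k₀ :=
    (Equiv.neg ℤ).subtypeEquiv fun k => by simp [neg_lt]
  have hp : 0 < (2 : ENNReal).toReal := by norm_num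
  have he (k : Set.Ioi (-k₀)) : J.reflect.weylSol z (-k₀) (J.B k₀ - z • 1 - M) k
      = J.weylSol z k₀ M (e k) := (J.weylSol_neg z k₀ M (Set.mem_Ici.2 (le_of_lt k.2))).symm
  simp only [IsWeylMinus, IsWeylPlus, he, memℓp_gen_iff hp]
  exact e.summable_iff.symm

theorem MMinus_eq (hz : 3 * J.reflect.bound < ‖z‖) (k₀ : ℤ) :
    J.MMinus z k₀ = J.B k₀ - z • 1 - J.reflect.MPlus z (-k₀) := by
  have hplus := existsUnique_isWeylPlus hz (-k₀)
  have hminus : ∃! M, J.IsWeylMinus z k₀ M :=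
    ((Equiv.subLeft (J.B k₀ - z • 1)).existsUnique_congr fun {_} => isWeylMinus_iff_reflect).2
      hplus
  have hMMinus : J.IsWeylMinus z k₀ (J.MMinus z k₀) := by
    rw [MMinus, dif_pos hminus]
    exact hminus.choose_spec.1
  rw [← hplus.unique (isWeylMinus_iff_reflect.1 hMMinus) (isWeylPlus_MPlus hz (-k₀)),
    sub_sub_cancel]

theorem eventually_isUnit_MMinus_sub_MPlus (J : JacobiCoeffs m) (hl : l ≤ cobounded ℂ) (k : ℤ) :
    ∀ᶠ z in l, IsUnit (J.MMinus z k - J.MPlus z k) := by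
  have hlim : Tendsto (fun z => J.B k - J.reflect.MPlus z (-k) - J.MPlus z k) l
      (𝓝 (J.B k - 0 - 0)) :=
    ((J.reflect.tendsto_MPlus hl (-k)).const_sub (J.B k)).sub (J.tendsto_MPlus hl k)
  filter_upwards [eventually_isUnit_sub_smul_one hl hlim,
    J.reflect.eventually_three_mul_bound_lt_norm hl] with z hunit hz
  rw [MMinus_eq hz]
  convert hunit using 1
  abel

theorem MMinus_eq_and_MPlus_eq_of_weylM_eq (hD : IsUnit (J.MMinus z k - J.MPlus z k))
    (h : J.weylM z k = J'.weylM z k) :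
    J.MMinus z k = J'.MMinus z k ∧ J.MPlus z k = J'.MPlus z k := by
  obtain ⟨hinv, hblock, -, -⟩ := Matrix.fromBlocks_inj.1 h
  have hsub : J.MMinus z k - J.MPlus z k = J'.MMinus z k - J'.MPlus z k :=
    Matrix.inv_inj hinv ((Matrix.isUnit_iff_isUnit_det _).1 hD)
  have hadd : J.MMinus z k + J.MPlus z k = J'.MMinus z k + J'.MPlus z k := by
    rw [← hinv] at hblock
    exact (Matrix.isUnit_nonsing_inv_iff.2 hD).mul_right_inj.1
      (smul_right_injective _ (inv_ne_zero two_ne_zero) hblock)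
  constructor
  · linear_combination (norm := module) (2⁻¹ : ℂ) • hadd + (2⁻¹ : ℂ) • hsub
  · linear_combination (norm := module) (2⁻¹ : ℂ) • hadd - (2⁻¹ : ℂ) • hsub

theorem B_eq_of_eventually_MMinus_eq [l.NeBot] (hl : l ≤ cobounded ℂ)
    (h : ∀ᶠ z in l, J.MMinus z k = J'.MMinus z k) : J.B k = J'.B k := by
  have hlim (J : JacobiCoeffs m) : Tendsto (fun z => J.MMinus z k + z • 1) l (𝓝 (J.B k)) := by
    have hlim' := (J.reflect.tendsto_MPlus hl (-k)).const_sub (J.B k)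
    rw [sub_zero] at hlim'
    refine hlim'.congr' ?_
    filter_upwards [J.reflect.eventually_three_mul_bound_lt_norm hl] with z hz
    rw [MMinus_eq hz]
    abel
  exact tendsto_nhds_unique_of_eventuallyEq (hlim J) (hlim J')
    (h.mono fun z hz => congrArg (· + z • 1) hz)

theorem eventually_reflect_MPlus_eq [l.NeBot] (hl : l ≤ cobounded ℂ)
    (h : ∀ᶠ z in l, J.MMinus z k = J'.MMinus z k) :
    ∀ᶠ z in l, J.reflect.MPlus z (-k) = J'.reflect.MPlus z (-k) := by
  filter_upwards [h, J.reflect.eventually_three_mul_bound_lt_norm hl,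
    J'.reflect.eventually_three_mul_bound_lt_norm hl] with z hM hz hz'
  rwa [MMinus_eq hz, MMinus_eq hz', B_eq_of_eventually_MMinus_eq hl h, sub_right_inj] at hM

theorem eq_of_eventually_MMinus_eq_of_eventually_MPlus_eq [l.NeBot] (hl : l ≤ cobounded ℂ)
    (hMinus : ∀ᶠ z in l, J.MMinus z k₀ = J'.MMinus z k₀)
    (hPlus : ∀ᶠ z in l, J.MPlus z k₀ = J'.MPlus z k₀) : J = J' := by
  have hright {k} (hk : k₀ ≤ k) := eventually_MPlus_eq_of_le hl hPlus hk
  have hleft {k} (hk : -k₀ ≤ k) :=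
    eventually_MPlus_eq_of_le hl (eventually_reflect_MPlus_eq hl hMinus) hk
  ext1 k
  · rcases le_or_gt k₀ k with hk | hk
    · exact A_eq_of_eventually_MPlus_eq hl (hright hk)
    · simpa [reflect] using A_eq_of_eventually_MPlus_eq hl (hleft (k := -k - 1) (by lia))
  · rcases lt_trichotomy k₀ k with hk | rfl | hk
    · simpa using B_succ_eq_of_eventually_MPlus_eq hl (hright (k := k - 1) (by lia))
    · exact B_eq_of_eventually_MMinus_eq hl hMinus
    · simpa [reflect] using
        B_succ_eq_of_eventually_MPlus_eq hl (hleft (k := -k - 1) (by lia))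

end JacobiCoeffs

theorem frequently_cobounded_im_pos : ∃ᶠ z in cobounded ℂ, 0 < z.im := by
  have hlim : Tendsto (fun y : ℝ => y * Complex.I) atTop (cobounded ℂ) := by
    refine tendsto_norm_atTop_iff_cobounded.1 ?_
    simpa using tendsto_abs_atTop_atTop
  refine hlim.frequently (Eventually.frequently ?_)
  filter_upwards [eventually_gt_atTop 0] with y hy
  simpa using hy

theorem theorem4p2_general {m : ℕ} {k₀ : ℤ} {J₁ J₂ : JacobiCoeffs m}
    (hM : ∃ᶠ z in cobounded ℂ, J₁.weylM z k₀ = J₂.weylM z k₀) : J₁ = J₂ := by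
  let l := cobounded ℂ ⊓ 𝓟 {z | J₁.weylM z k₀ = J₂.weylM z k₀}
  have hl : l ≤ cobounded ℂ := inf_le_left
  have : l.NeBot := frequently_iff_neBot.1 hM
  have hM' : ∀ᶠ z in l, J₁.weylM z k₀ = J₂.weylM z k₀ := mem_inf_of_right (mem_principal_self _)
  have hMinus_and_hPlus :=
    ((J₁.eventually_isUnit_MMinus_sub_MPlus hl k₀).and hM').mono fun z hz =>
      JacobiCoeffs.MMinus_eq_and_MPlus_eq_of_weylM_eq hz.1 hz.2
  exact JacobiCoeffs.eq_of_eventually_MMinus_eq_of_eventually_MPlus_eq hl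
    (hMinus_and_hPlus.mono fun z => And.left) (hMinus_and_hPlus.mono fun z => And.right)

theorem theorem4p2 (m : ℕ) (k₀ : ℤ) (J₁ J₂ : JacobiCoeffs m)
    (hM : ∀ z : ℂ, 0 < z.im → J₁.weylM z k₀ = J₂.weylM z k₀) :
    J₁.H = J₂.H ∧ (∀ k : ℤ, J₁.A k = J₂.A k) ∧ (∀ k : ℤ, J₁.B k = J₂.B k) := by
  obtain rfl := theorem4p2_general (frequently_cobounded_im_pos.mono hM)
  exact ⟨rfl, fun _ => rfl, fun _ => rfl⟩
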